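/- A linear order $L$ is called countably saturated if for any countable (possibly finite or empty) linear orders $a, b$ and any strictly increasing functions $i : a \to b$ and $f : a \to L$ there exists a strictly increasing function $\tilde f : b \to L$ with $\tilde f \circ i = f$. A countably saturated linear order $L$ is called prime if every countably saturated linear order contains an isomorphic copy of $L$. Theorem (Harzheim). In ZFC (without assuming the continuum hypothesis), there exists a prime countably saturated linear order of cardinality $\mathfrak{c} = 2^{\aleph_0}$, and any two prime countably saturated linear orders are isomorphic. -/

import Mathlib

universe u

/-- A linear order `L` is countably saturated if for any countable (possibly finite or empty) linear
orders `a`, `b`, every strictly increasing `f : a → L` extends along every strictly increasing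
`i : a → b` to a strictly increasing map `b → L`. -/
def CountablySaturated (L : Type u) [LinearOrder L] : Prop :=
  ∀ (a b : Type u) [LinearOrder a] [LinearOrder b] [Countable a] [Countable b]
    (i : a → b) (f : a → L), StrictMono i → StrictMono f →
    ∃ g : b → L, StrictMono g ∧ g ∘ i = f

/-- A linear order is prime countably saturated if it is countably saturated and every countably
saturated linear order contains an isomorphic copy of it. -/
def PrimeCountablySaturated (L : Type u) [LinearOrder L] : Prop :=
  CountablySaturated L ∧
    ∀ (X : Type u) [LinearOrder X], CountablySaturated X → Nonempty (L ↪o X)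

/-! Countable saturation is Hausdorff's `η₁` condition. The prime model consists of the binary
`ω₁`-sequences with a last one, ordered lexicographically; `W` plays the role of `ω₁`. Read as a
tree of left/right decisions, such a sequence selects a point in any `η₁` order `P`: at each stage a
choice function picks a point of the current cell, which is nonempty because only countably many
constraints are active. This embeds the model in `P`. For uniqueness, rank a sequence by the
position of its last one. No rank level contains a strictly monotone or antitone `ω₁`-sequence, and
suborders inherit this, so every prime order has such a rank. If the choice function always takes a
point of least rank, the embedding becomes onto: a point missed by its own branch would dominate in
rank uncountably many branch points, which lie in countably many levels. Without the continuum
hypothesis the model still has only `ℵ₁ * 2 ^ ℵ₀ = 𝔠` elements. -/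

/-! ### Saturation and the `η₁` condition. -/

/-- Countable cuts are filled: Hausdorff's `η₁` condition. -/
def FillsCountableCuts (L : Type*) [LinearOrder L] : Prop :=
  ∀ A B : Set L, A.Countable → B.Countable → (∀ a ∈ A, ∀ b ∈ B, a < b) →
    ∃ x, (∀ a ∈ A, a < x) ∧ ∀ b ∈ B, x < b

/-- Extend the inclusion of `A ⊕ₗ B` to an order with one extra point in the middle. -/
theorem CountablySaturated.fillsCountableCuts {L : Type u} [LinearOrder L]
    (hL : CountablySaturated L) : FillsCountableCuts L := by
  intro A B hA hB hAB
  have := hA.to_subtype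
  have := hB.to_subtype
  have hcount : ∀ (S T : Type u) [Countable S] [Countable T], Countable (S ⊕ₗ T) :=
    fun S T _ _ => inferInstanceAs (Countable (S ⊕ T))
  have := hcount A B
  have := hcount PUnit.{u + 1} B
  have := hcount A (PUnit.{u + 1} ⊕ₗ B)
  let i : A ⊕ₗ B → A ⊕ₗ (PUnit.{u + 1} ⊕ₗ B) := fun s =>
    Sum.elim (fun a => toLex (Sum.inl a)) (fun b => toLex (Sum.inr (toLex (Sum.inr b)))) (ofLex s)
  let f : A ⊕ₗ B → L := fun s => Sum.elim Subtype.val Subtype.val (ofLex s)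
  have hi : StrictMono i := by
    rintro (a | b) (c | d) h
    · exact Sum.Lex.inl_lt_inl_iff.2 (Sum.Lex.inl_lt_inl_iff.1 h)
    · exact Sum.Lex.inl_lt_inr _ _
    · exact absurd h Sum.Lex.not_inr_lt_inl
    · exact Sum.Lex.inr_lt_inr_iff.2 (Sum.Lex.inr_lt_inr_iff.2 (Sum.Lex.inr_lt_inr_iff.1 h))
  have hf : StrictMono f := by
    rintro (a | b) (c | d) h
    · exact (Sum.Lex.inl_lt_inl_iff (α := A) (β := B)).1 h
    · exact hAB _ a.2 _ d.2
    · exact absurd h Sum.Lex.not_inr_lt_inl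
    · exact (Sum.Lex.inr_lt_inr_iff (α := A) (β := B)).1 h
  obtain ⟨g, hg, hgi⟩ := hL _ _ i f hi hf
  refine ⟨g (toLex (Sum.inr (toLex (Sum.inl PUnit.unit)))), fun a ha => ?_, fun b hb => ?_⟩
  · have h := congrFun hgi (toLex (Sum.inl ⟨a, ha⟩))
    change g (toLex (Sum.inl ⟨a, ha⟩)) = a at h
    rw [← h]
    exact hg (Sum.Lex.inl_lt_inr _ _)
  · have h := congrFun hgi (toLex (Sum.inr ⟨b, hb⟩))
    change g (toLex (Sum.inr (toLex (Sum.inr ⟨b, hb⟩)))) = b at h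
    rw [← h]
    exact hg (Sum.Lex.inr_lt_inr_iff.2 (Sum.Lex.inl_lt_inr _ _))

theorem FillsCountableCuts.nonempty {L : Type*} [LinearOrder L] (hL : FillsCountableCuts L) :
    Nonempty L :=
  let ⟨x, _⟩ := hL ∅ ∅ Set.countable_empty Set.countable_empty (by simp)
  ⟨x⟩

/-- Enumerate `b` and place its points one at a time: each new point has to fill a cut given by `f`
and the values already chosen. -/
theorem FillsCountableCuts.countablySaturated {L : Type u} [LinearOrder L]
    (hL : FillsCountableCuts L) : CountablySaturated L := by
  classical
  intro a b _ _ _ _ i f hi hf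
  have := hL.nonempty
  obtain ⟨e, he⟩ := exists_injective_nat b
  let Good (x : b) (v : b → L) (p : L) : Prop :=
    (∀ s, (i s < x → f s < p) ∧ (x < i s → p < f s) ∧ (i s = x → p = f s)) ∧
      ∀ y, e y < e x → (y < x → v y < p) ∧ (x < y → p < v y)
  -- The recursion is run with a conditional specification; that candidates exist is proved
  -- afterwards by induction.
  have hrec : ∃ g : b → L, ∀ x, (∃ p, Good x g p) → Good x g (g x) := by
    let F : (x : b) → ((y : b) → e y < e x → L) → L := fun x prev =>
      Classical.epsilon (Good x (fun y => if h : e y < e x then prev y h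
        else Classical.arbitrary L))
    refine ⟨(measure e).wf.fix F, fun x hx => ?_⟩
    rw [WellFounded.fix_eq]
    have hcongr : ∀ p, Good x (fun y => if h : e y < e x then (measure e).wf.fix F y
        else Classical.arbitrary L) p ↔ Good x ((measure e).wf.fix F) p := by
      intro p
      refine and_congr_right fun _ => forall_congr' fun y => forall_congr' fun hy => ?_
      simp only [hy, dif_pos]
    obtain ⟨p, hp⟩ := hx
    exact (hcongr _).1 (Classical.epsilon_spec ⟨p, (hcongr p).2 hp⟩)
  obtain ⟨g, hg⟩ := hrec
  have hgood : ∀ n, ∀ x, e x = n → Good x g (g x) := by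
    intro n
    induction n using Nat.strong_induction_on with
    | _ n ih =>
    rintro x rfl
    refine hg x ?_
    have hprev : ∀ y, e y < e x → Good y g (g y) := fun y hy => ih _ hy y rfl
    by_cases hx : ∃ s, i s = x
    · obtain ⟨s, rfl⟩ := hx
      refine ⟨f s, fun t => ⟨fun h => hf (hi.lt_iff_lt.1 h), fun h => hf (hi.lt_iff_lt.1 h),
        fun h => by rw [hi.injective h]⟩, fun y hy => ⟨fun h => ?_, fun h => ?_⟩⟩
      · exact ((hprev y hy).1 s).2.1 h
      · exact ((hprev y hy).1 s).1 h
    · obtain ⟨p, hpA, hpB⟩ := hL (f '' {s | i s < x} ∪ g '' {y | e y < e x ∧ y < x})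
        (f '' {s | x < i s} ∪ g '' {y | e y < e x ∧ x < y})
        (((Set.to_countable _).image _).union ((Set.to_countable _).image _))
        (((Set.to_countable _).image _).union ((Set.to_countable _).image _)) (by
          rintro _ (⟨s, hs, rfl⟩ | ⟨y, ⟨hy, hyx⟩, rfl⟩) _ (⟨t, ht, rfl⟩ | ⟨z, ⟨hz, hxz⟩, rfl⟩)
          · exact hf (hi.lt_iff_lt.1 (lt_trans hs ht))
          · exact ((hprev z hz).1 s).1 (lt_trans hs hxz)
          · exact ((hprev y hy).1 t).2.1 (lt_trans hyx ht)
          · have hyz := hyx.trans hxz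
            rcases lt_trichotomy (e y) (e z) with h | h | h
            · exact ((hprev z hz).2 y h).1 hyz
            · exact absurd (he h) hyz.ne
            · exact ((hprev y hy).2 z h).2 hyz)
      refine ⟨p, fun s => ⟨fun h => hpA _ (Or.inl ⟨s, h, rfl⟩),
        fun h => hpB _ (Or.inl ⟨s, h, rfl⟩), fun h => absurd ⟨s, h⟩ hx⟩, fun y hy =>
        ⟨fun h => hpA _ (Or.inr ⟨y, ⟨hy, h⟩, rfl⟩), fun h => hpB _ (Or.inr ⟨y, ⟨hy, h⟩, rfl⟩)⟩⟩
  refine ⟨g, fun y z hyz => ?_, funext fun s => ((hgood _ _ rfl).1 s).2.2 rfl⟩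
  rcases lt_trichotomy (e y) (e z) with h | h | h
  · exact ((hgood _ z rfl).2 y h).1 hyz
  · exact absurd (he h) hyz.ne
  · exact ((hgood _ y rfl).2 z h).2 hyz

/-! ### Binary sequences with a last one. -/

/-- Binary `W`-sequences with a last `true`, to be ordered lexicographically. -/
def LastOne (W : Type*) [LinearOrder W] : Type _ :=
  {f : Lex (W → Bool) // ∃ m, f m = true ∧ ∀ n, m < n → f n = false}

namespace LastOne

variable {W : Type*} [LinearOrder W]

noncomputable instance [WellFoundedLT W] : LinearOrder (LastOne W) :=
  inferInstanceAs (LinearOrder {f : Lex (W → Bool) // ∃ m, f m = true ∧ ∀ n, m < n → f n = false})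

instance : CoeFun (LastOne W) fun _ => W → Bool := ⟨fun f => ofLex f.1⟩

/-- The position of the last `true`. -/
noncomputable def last (f : LastOne W) : W := f.2.choose

theorem apply_last (f : LastOne W) : f f.last = true := f.2.choose_spec.1

theorem apply_of_last_lt (f : LastOne W) {n : W} (h : f.last < n) : f n = false :=
  f.2.choose_spec.2 n h

theorem le_last (f : LastOne W) {n : W} (h : f n = true) : n ≤ f.last := by
  by_contra hn
  simp [f.apply_of_last_lt (not_le.1 hn)] at h

theorem last_eq (f : LastOne W) {m : W} (hm : f m = true) (h : ∀ n, m < n → f n = false) :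
    f.last = m := by
  refine le_antisymm ?_ (f.le_last hm)
  by_contra hn
  simpa [f.apply_last] using h _ (not_le.1 hn)

/-- Build an element from a sequence and the position of its last `true`. -/
def of (f : W → Bool) (m : W) (hm : f m = true) (h : ∀ n, m < n → f n = false) : LastOne W :=
  ⟨toLex f, m, hm, h⟩

@[simp] theorem coe_of (f : W → Bool) (m : W) (hm h) : ⇑(of f m hm h) = f := rfl

theorem ext {f g : LastOne W} (h : ∀ n, f n = g n) : f = g := Subtype.ext (funext h)

theorem lt_iff [WellFoundedLT W] {f g : LastOne W} :
    f < g ↔ ∃ i, (∀ j < i, f j = g j) ∧ f i = false ∧ g i = true := by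
  change (∃ i, (∀ j, j < i → f j = g j) ∧ f i < g i) ↔ _
  simp only [Bool.lt_iff]

/-- Lexicographic suprema in the space of binary sequences. -/
theorem exists_lexSup [WellFoundedLT W] (A : Set (W → Bool)) :
    ∃ g : W → Bool, ∀ n, g n = true ↔ ∃ a ∈ A, (∀ j < n, a j = g j) ∧ a n = true := by
  classical
  let F : (n : W) → ((j : W) → j < n → Bool) → Bool := fun n prev =>
    decide (∃ a ∈ A, (∀ j, ∀ h : j < n, a j = prev j h) ∧ a n = true)
  refine ⟨(wellFounded_lt (α := W)).fix F, fun n => ?_⟩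
  rw [WellFounded.fix_eq]
  simp [F]

/-- The lexicographic supremum `g` of `A` lies weakly between `A` and `B`, but may lack a last one
or belong to `A` or `B`. A position `d` beyond all last ones leaves room to correct it. -/
theorem fillsCountableCuts [WellFoundedLT W]
    (hW : ∀ S : Set W, S.Countable → ∃ m, ∀ s ∈ S, s < m) : FillsCountableCuts (LastOne W) := by
  classical
  intro A B hA hB hAB
  obtain ⟨g, hg⟩ := exists_lexSup ((fun f : LastOne W => (f : W → Bool)) '' A)
  simp only [Set.exists_mem_image] at hg
  obtain ⟨d, hd⟩ := hW (last '' (A ∪ B)) ((hA.union hB).image _)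
  have hdA : ∀ a ∈ A, a.last < d := fun a ha => hd _ ⟨a, Or.inl ha, rfl⟩
  have hdB : ∀ b ∈ B, b.last < d := fun b hb => hd _ ⟨b, Or.inr hb, rfl⟩
  have hgd : ∀ n, d ≤ n → g n = false := by
    intro n hn
    by_contra h
    obtain ⟨a, ha, -, h1⟩ := (hg n).1 (by simpa using h)
    exact absurd (a.le_last h1) (not_le.2 ((hdA a ha).trans_le hn))
  -- The first place where a sequence differs from `g`.
  have hdiff : ∀ f : LastOne W, (∃ n, f n ≠ g n) → ∃ n, (∀ j < n, f j = g j) ∧ f n ≠ g n := by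
    intro f hf
    obtain ⟨n, hn, hmin⟩ := wellFounded_lt.has_min {n | f n ≠ g n} hf
    exact ⟨n, fun j hj => not_not.1 fun h => hmin j h hj, hn⟩
  have hAg : ∀ a ∈ A, (∃ n, a n ≠ g n) → ∃ n, (∀ j < n, a j = g j) ∧ a n = false ∧ g n = true := by
    intro a ha hne
    obtain ⟨n, hn, hne⟩ := hdiff a hne
    refine ⟨n, hn, ?_⟩
    cases h1 : a n
    · simpa [h1] using hne
    · exact absurd (h1.trans ((hg n).2 ⟨a, ha, hn, h1⟩).symm) hne
  have hBg : ∀ b ∈ B, (∃ n, b n ≠ g n) → ∃ n, (∀ j < n, g j = b j) ∧ g n = false ∧ b n = true := by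
    intro b hb hne
    obtain ⟨n, hn, hne⟩ := hdiff b hne
    refine ⟨n, fun j hj => (hn j hj).symm, ?_⟩
    cases h1 : g n
    · simpa [h1] using hne
    · obtain ⟨a, ha, hj, h2⟩ := (hg n).1 h1
      refine absurd (hAB a ha b hb) (not_lt.2 (le_of_lt (lt_iff.2 ⟨n, fun j hjn => ?_, ?_, h2⟩)))
      · rw [hn j hjn, hj j hjn]
      · simpa [h1] using hne
  by_cases hgB : ∃ b ∈ B, ∀ n, b n = g n
  · obtain ⟨b, hb, hbg⟩ := hgB
    have hbd := hdB b hb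
    -- Here `g = b` must be lowered: its last one becomes a zero, followed by ones up to `d`. Any
    -- `a` agreeing with it through `b.last` still has a zero by `d`, so stays below.
    let h : W → Bool := fun n => if n < b.last then g n else decide (b.last < n ∧ n ≤ d)
    have hlt : ∀ n, n < b.last → h n = g n := fun n hn => if_pos hn
    have hl : h b.last = false := by simp [h]
    have hgt : ∀ n, b.last < n → n ≤ d → h n = true := fun n hn hnd => by
      simp [h, hn, hnd, hn.not_gt]
    have hzero : ∀ n, d < n → h n = false := fun n hn => by
      simp [h, hn.not_ge, (hbd.trans hn).not_gt]
    have hhb : of h d (hgt d hbd le_rfl) hzero < b :=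
      lt_iff.2 ⟨b.last, fun j hj => (hlt j hj).trans (hbg j).symm, hl, b.apply_last⟩
    refine ⟨of h d (hgt d hbd le_rfl) hzero, fun a ha => ?_, fun c hc => ?_⟩
    rotate_left
    · by_cases hcg : ∃ n, c n ≠ g n
      · obtain ⟨n, h1, h2, h3⟩ := hBg c hc hcg
        exact hhb.trans (lt_iff.2 ⟨n, fun j hj => (hbg j).trans (h1 j hj), (hbg n).trans h2, h3⟩)
      · push Not at hcg
        rwa [show c = b from ext fun n => (hcg n).trans (hbg n).symm]
    · have hne : ∃ n, a n ≠ g n := by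
        by_contra hcon
        push Not at hcon
        exact (hAB a ha b hb).ne (ext fun n => (hcon n).trans (hbg n).symm)
      obtain ⟨n, h1, h2, h3⟩ := hAg a ha hne
      have hnb : n ≤ b.last := b.le_last ((hbg n).trans h3)
      rcases hnb.lt_or_eq with hn | rfl
      · exact lt_iff.2 ⟨n, fun j hj => (h1 j hj).trans (hlt j (hj.trans hn)).symm, h2,
          (hlt n hn).trans h3⟩
      · have had : ∃ n, b.last < n ∧ n ≤ d ∧ a n = false :=
          ⟨d, hbd, le_rfl, a.apply_of_last_lt (hdA a ha)⟩
        obtain ⟨k, ⟨hk1, hk2, hk3⟩, hmin⟩ := wellFounded_lt.has_min _ had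
        refine lt_iff.2 ⟨k, fun j hj => ?_, hk3, hgt k hk1 hk2⟩
        rcases lt_trichotomy j b.last with hjb | rfl | hjb
        · exact (h1 j hjb).trans (hlt j hjb).symm
        · exact h2.trans hl.symm
        · refine Eq.trans ?_ (hgt j hjb (hj.le.trans hk2)).symm
          by_contra hcon
          exact hmin j ⟨hjb, hj.le.trans hk2, by simpa using hcon⟩ hj
  · push Not at hgB
    -- Here `g` is strictly below `B`, with the difference before `d`, so a one added at `d` lifts
    -- it above `A` without reaching `B`.
    let h : W → Bool := Function.update g d true
    have hlt : ∀ n, n ≠ d → h n = g n := fun n hn => Function.update_of_ne hn _ _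
    have hhd : h d = true := Function.update_self ..
    refine ⟨of h d hhd fun n hn => (hlt n hn.ne').trans (hgd n hn.le), fun a ha => ?_,
      fun b hb => ?_⟩
    · by_cases hne : ∃ n, a n ≠ g n
      · obtain ⟨n, h1, h2, h3⟩ := hAg a ha hne
        have hnd : n < d := by
          by_contra hcon
          simp [hgd n (not_lt.1 hcon)] at h3
        exact lt_iff.2 ⟨n, fun j hj => (h1 j hj).trans (hlt j (hj.trans hnd).ne).symm, h2,
          (hlt n hnd.ne).trans h3⟩
      · push Not at hne
        exact lt_iff.2 ⟨d, fun j hj => (hne j).trans (hlt j hj.ne).symm,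
          a.apply_of_last_lt (hdA a ha), hhd⟩
    · obtain ⟨n, h1, h2, h3⟩ := hBg b hb (hgB b hb)
      have hnd : n < d := (b.le_last h3).trans_lt (hdB b hb)
      exact lt_iff.2 ⟨n, fun j hj => (hlt j (hj.trans hnd).ne).trans (h1 j hj),
        (hlt n hnd.ne).trans h2, h3⟩

end LastOne

/-! ### Branches through an `η₁` order. -/

section Paths

variable {W P : Type*} [LinearOrder W] [LinearOrder P]

/-- The points that lie, for each `j < n`, on the side of `y j` prescribed by `f j`. -/
def pathCell (f : W → Bool) (y : W → P) (n : W) : Set P :=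
  {q | ∀ j < n, (f j = true → y j < q) ∧ (f j = false → q < y j)}

theorem pathCell_congr {f f' : W → Bool} {y y' : W → P} {n : W} (hf : ∀ j < n, f j = f' j)
    (hy : ∀ j < n, y j = y' j) : pathCell f y n = pathCell f' y' n := by
  ext q
  refine forall_congr' fun j => forall_congr' fun hj => ?_
  rw [hf j hj, hy j hj]

theorem exists_pathPoint [WellFoundedLT W] (pick : Set P → P) (f : W → Bool) :
    ∃ y : W → P, ∀ n, y n = pick (pathCell f y n) := by
  let F : (n : W) → ((j : W) → j < n → P) → P := fun n prev =>
    pick {q | ∀ j, ∀ h : j < n, (f j = true → prev j h < q) ∧ (f j = false → q < prev j h)}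
  refine ⟨(wellFounded_lt (α := W)).fix F, fun n => ?_⟩
  rw [WellFounded.fix_eq]
  rfl

/-- The points selected along the branch `f`. -/
noncomputable def pathPoint [WellFoundedLT W] (pick : Set P → P) (f : W → Bool) : W → P :=
  (exists_pathPoint pick f).choose

theorem pathPoint_eq [WellFoundedLT W] (pick : Set P → P) (f : W → Bool) (n : W) :
    pathPoint pick f n = pick (pathCell f (pathPoint pick f) n) :=
  (exists_pathPoint pick f).choose_spec n

theorem pathPoint_unique [WellFoundedLT W] {pick : Set P → P} {f : W → Bool} {y : W → P} {m : W}
    (hy : ∀ n < m, y n = pick (pathCell f y n)) : ∀ n < m, pathPoint pick f n = y n := by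
  intro n
  induction n using WellFoundedLT.induction with
  | _ n ih =>
  intro hn
  rw [pathPoint_eq, hy n hn, pathCell_congr (fun _ _ => rfl) fun j hj => ih j hj (hj.trans hn)]

theorem pathPoint_congr [WellFoundedLT W] {pick : Set P → P} {f g : W → Bool} {m : W}
    (h : ∀ j < m, f j = g j) : pathPoint pick f m = pathPoint pick g m := by
  have hlt : ∀ n < m, pathPoint pick f n = pathPoint pick g n :=
    pathPoint_unique fun n hn => by
      rw [pathPoint_eq]
      exact congrArg pick (pathCell_congr (fun j hj => (h j (hj.trans hn)).symm) fun _ _ => rfl)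
  rw [pathPoint_eq, pathPoint_eq pick g, pathCell_congr h hlt]

/-- Cells are never empty: by induction the earlier points turned right at lie below those turned
left at, and both sets are countable. -/
theorem pathPoint_mem [WellFoundedLT W] (hW : ∀ n : W, (Set.Iio n).Countable)
    (hP : FillsCountableCuts P) {pick : Set P → P} (hpick : ∀ S : Set P, S.Nonempty → pick S ∈ S)
    (f : W → Bool) (n : W) : pathPoint pick f n ∈ pathCell f (pathPoint pick f) n := by
  induction n using WellFoundedLT.induction with
  | _ n ih =>
  have hmem := hpick (pathCell f (pathPoint pick f) n)
  rw [← pathPoint_eq pick f n] at hmem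
  apply hmem
  obtain ⟨x, hx1, hx2⟩ := hP (pathPoint pick f '' {j | j < n ∧ f j = true})
    (pathPoint pick f '' {j | j < n ∧ f j = false})
    (((hW n).mono fun _ h => h.1).image _) (((hW n).mono fun _ h => h.1).image _) (by
      rintro _ ⟨i, ⟨hi, hfi⟩, rfl⟩ _ ⟨j, ⟨hj, hfj⟩, rfl⟩
      rcases lt_trichotomy i j with h | rfl | h
      · exact (ih j hj i h).1 hfi
      · simp [hfi] at hfj
      · exact (ih i hi j h).2 hfj)
  exact ⟨x, fun j hj => ⟨fun h => hx1 _ ⟨j, ⟨hj, h⟩, rfl⟩, fun h => hx2 _ ⟨j, ⟨hj, h⟩, rfl⟩⟩⟩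

/-- Up to the first difference `n` the branches share their points. Either `f` stops before `n`,
where `g` goes right, or `f` goes left of the common point at `n` while `g` stops there or goes
right. -/
theorem LastOne.pathPoint_strictMono [WellFoundedLT W] (hW : ∀ n : W, (Set.Iio n).Countable)
    (hP : FillsCountableCuts P) {pick : Set P → P} (hpick : ∀ S : Set P, S.Nonempty → pick S ∈ S) :
    StrictMono fun f : LastOne W => pathPoint pick f f.last := by
  intro f g hfg
  have hmem := pathPoint_mem hW hP hpick
  obtain ⟨n, hn, hf, hg⟩ := LastOne.lt_iff.1 hfg
  have hgl : n ≤ g.last := g.le_last hg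
  have hle : pathPoint pick g n ≤ pathPoint pick g g.last := by
    rcases hgl.eq_or_lt with h | h
    · rw [← h]
    · exact ((hmem g _ n h).1 hg).le
  rcases lt_trichotomy f.last n with h | h | h
  · have h1 : g f.last = true := (hn _ h).symm.trans f.apply_last
    have h2 := (hmem g _ _ (h.trans_le hgl)).1 h1
    rwa [← pathPoint_congr fun j hj => hn j (hj.trans h)] at h2
  · rw [← h, f.apply_last] at hf
    cases hf
  · refine ((hmem f _ n h).2 hf).trans_le ?_
    rwa [pathPoint_congr hn]

theorem LastOne.nonempty_orderEmbedding [WellFoundedLT W]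
    (hW : ∀ n : W, (Set.Iio n).Countable) (hP : FillsCountableCuts P) :
    Nonempty (LastOne W ↪o P) := by
  classical
  have := hP.nonempty
  exact ⟨OrderEmbedding.ofStrictMono _ (LastOne.pathPoint_strictMono hW hP
    (pick := fun S => Classical.epsilon (· ∈ S)) fun S hS => Classical.epsilon_spec hS)⟩

/-! ### Thin ranks and uniqueness. -/

/-- A rank function to `W` none of whose levels contains an uncountable `W`-sequence that is
strictly monotone or strictly antitone. -/
def HasThinRank (W P : Type*) [LinearOrder W] [LinearOrder P] : Prop :=
  ∃ ρ : P → W, ∀ (d : W) (S : Set W) (y : W → P), (∀ s ∈ S, ρ (y s) = d) →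
    (StrictMonoOn y S ∨ StrictAntiOn y S) → S.Countable

theorem HasThinRank.of_orderEmbedding {Q : Type*} [LinearOrder Q] (h : HasThinRank W Q)
    (e : P ↪o Q) : HasThinRank W P := by
  obtain ⟨ρ, hρ⟩ := h
  refine ⟨ρ ∘ e, fun d S y hd hy => hρ d S (e ∘ y) hd ?_⟩
  exact hy.imp (fun h => e.strictMono.comp_strictMonoOn h) fun h => e.strictMono.comp_strictAntiOn h

/-- An increasing (in the weak lexicographic sense) uncountable sequence of binary sequences is
eventually constant on every countable initial segment. -/
theorem lex_eventually_const [WellFoundedLT W] (hW : ∀ n : W, (Set.Iic n).Countable) {S : Set W}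
    (hS : ¬ S.Countable) {y : W → W → Bool}
    (hy : ∀ s ∈ S, ∀ t ∈ S, s < t → ∀ n, (∀ j < n, y s j = y t j) → y s n ≤ y t n) (n : W) :
    ∃ m ∈ S, ∀ s ∈ S, m ≤ s → y s n = y m n := by
  induction n using WellFoundedLT.induction with
  | _ n ih =>
  choose m hmS hm using ih
  have hcount : (⋃ j : Set.Iio n, Set.Iic (m j j.2)).Countable := by
    have := ((hW n).mono Set.Iio_subset_Iic_self).to_subtype
    exact Set.countable_iUnion fun j => hW _
  have hbound : ∃ b ∈ S, ∀ j (hj : j < n), m j hj < b := by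
    by_contra hcon
    push Not at hcon
    refine hS (hcount.mono fun s hs => ?_)
    obtain ⟨j, hj, h⟩ := hcon s hs
    exact Set.mem_iUnion.2 ⟨⟨j, hj⟩, h⟩
  -- Beyond `b` all coordinates before `n` are frozen, so coordinate `n` is monotone in `s` and
  -- changes at most once.
  obtain ⟨b, hbS, hb⟩ := hbound
  have hagree : ∀ s ∈ S, ∀ t ∈ S, b ≤ s → b ≤ t → ∀ j < n, y s j = y t j :=
    fun s hs t ht hbs hbt j hj =>
    (hm j hj s hs ((hb j hj).le.trans hbs)).trans (hm j hj t ht ((hb j hj).le.trans hbt)).symm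
  have hmono : ∀ s ∈ S, ∀ t ∈ S, b ≤ s → s ≤ t → y s n ≤ y t n := fun s hs t ht hbs hst => by
    rcases hst.eq_or_lt with rfl | h
    · exact le_rfl
    · exact hy s hs t ht h n (hagree s hs t ht hbs (hbs.trans hst))
  by_cases hone : ∃ s ∈ S, b ≤ s ∧ y s n = true
  · obtain ⟨s, hs, hbs, h1⟩ := hone
    refine ⟨s, hs, fun t ht hst => ?_⟩
    have := hmono s hs t ht hbs hst
    rw [h1] at this ⊢
    exact top_le_iff.1 this
  · push Not at hone
    refine ⟨b, hbS, fun s hs hbs => ?_⟩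
    rw [Bool.eq_false_of_not_eq_true (hone s hs hbs),
      Bool.eq_false_of_not_eq_true (hone b hbS le_rfl)]

/-- Sequences whose last one is at `d` are determined by countably many coordinates. Along an
uncountable monotone family each of these stabilises, so the family is constant from some countable
stage on. -/
theorem LastOne.hasThinRank [WellFoundedLT W] (hW : ∀ n : W, (Set.Iic n).Countable) :
    HasThinRank W (LastOne W) := by
  refine ⟨LastOne.last, fun d S y hd hy => ?_⟩
  by_contra hS
  have key : ∀ n, ∃ m ∈ S, ∀ s ∈ S, m ≤ s → y s n = y m n := by
    have hlex : ∀ f g : LastOne W, f < g → ∀ n, (∀ j < n, f j = g j) → f n ≤ g n := by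
      intro f g hfg n hn
      obtain ⟨i, h1, h2, h3⟩ := LastOne.lt_iff.1 hfg
      rcases lt_trichotomy i n with h | rfl | h
      · have := hn i h
        simp [h2, h3] at this
      · simp [h2]
      · exact (h1 n h).le
    rcases hy with hy | hy
    · exact lex_eventually_const hW hS (y := fun s => y s) fun s hs t ht hst n hn =>
        hlex _ _ (hy hs ht hst) n hn
    · intro n
      -- Complementing the bits turns the antitone case into the monotone one.
      obtain ⟨m, hmS, hm⟩ := lex_eventually_const hW hS (y := fun s n => !(y s n))
        (fun s hs t ht hst n hn => by
          have := hlex _ _ (hy hs ht hst) n fun j hj => by simpa using (hn j hj).symm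
          revert this
          cases y s n <;> cases y t n <;> simp) n
      exact ⟨m, hmS, fun s hs h => by simpa using hm s hs h⟩
  choose m hmS hm using key
  have hcount : (⋃ j : Set.Iic d, Set.Iic (m j)).Countable := by
    have := (hW d).to_subtype
    exact Set.countable_iUnion fun j => hW _
  have htail : ∀ s ∈ S, ∀ t ∈ S, s ∉ ⋃ j : Set.Iic d, Set.Iic (m j) → s < t → y s = y t := by
    intro s hs t ht hsm hst
    refine LastOne.ext fun n => ?_
    by_cases hn : n ≤ d
    · have h : m n ≤ s := by
        by_contra hcon
        exact hsm (Set.mem_iUnion.2 ⟨⟨n, hn⟩, (not_le.1 hcon).le⟩)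
      exact (hm n s hs h).trans (hm n t ht (h.trans hst.le)).symm
    · rw [(y s).apply_of_last_lt (by rw [hd s hs]; exact not_le.1 hn),
        (y t).apply_of_last_lt (by rw [hd t ht]; exact not_le.1 hn)]
  have hex : ∃ s ∈ S, s ∉ ⋃ j : Set.Iic d, Set.Iic (m j) := by
    by_contra hcon
    push Not at hcon
    exact hS (hcount.mono hcon)
  obtain ⟨s, hs, hsm⟩ := hex
  have hex2 : ∃ t ∈ S, s < t := by
    by_contra hcon
    push Not at hcon
    exact hS ((hW s).mono hcon)
  obtain ⟨t, ht, hst⟩ := hex2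
  have := htail s hs t ht hsm hst
  rcases hy with hy | hy
  · exact (hy hs ht hst).ne this
  · exact (hy hs ht hst).ne this.symm

/-- With rank-minimal picks, a point `p` not met by its branch stays in every cell, so all branch
points have rank at most `ρ p`. Those below `p` increase and those above decrease, so thinness
leaves only countably many stages. -/
theorem LastOne.nonempty_orderIso [WellFoundedLT W] [Uncountable W]
    (hW : ∀ n : W, (Set.Iic n).Countable) (hP : FillsCountableCuts P) (hρ : HasThinRank W P) :
    Nonempty (LastOne W ≃o P) := by
  classical
  obtain ⟨ρ, hρ⟩ := hρ
  have := hP.nonempty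
  have hW' : ∀ n : W, (Set.Iio n).Countable := fun n => (hW n).mono Set.Iio_subset_Iic_self
  have hpick : ∀ S : Set P, ∃ x, S.Nonempty → x ∈ S ∧ ∀ q ∈ S, ρ x ≤ ρ q := by
    intro S
    by_cases hS : S.Nonempty
    · obtain ⟨x, hx, hmin⟩ := (InvImage.wf ρ wellFounded_lt).has_min S hS
      exact ⟨x, fun _ => ⟨hx, fun q hq => not_lt.1 (hmin q hq)⟩⟩
    · exact ⟨Classical.arbitrary P, fun h => absurd h hS⟩
  choose pick hpick using hpick
  have hmono := LastOne.pathPoint_strictMono hW' hP fun S hS => (hpick S hS).1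
  refine ⟨hmono.orderIsoOfSurjective _ fun p => ?_⟩
  -- Follow the branch of `p`; it meets `p` at a countable stage.
  obtain ⟨y, hy⟩ : ∃ y : W → P, ∀ n, y n = pick (pathCell (fun j => decide (y j < p)) y n) := by
    let F : (n : W) → ((j : W) → j < n → P) → P := fun n prev =>
      pick {q | ∀ j, ∀ h : j < n, (decide (prev j h < p) = true → prev j h < q) ∧
        (decide (prev j h < p) = false → q < prev j h)}
    refine ⟨(wellFounded_lt (α := W)).fix F, fun n => ?_⟩
    rw [WellFounded.fix_eq]
    rfl
  have hmeet : ∃ n, y n = p := by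
    by_contra hne
    push Not at hne
    have hp : ∀ n, p ∈ pathCell (fun j => decide (y j < p)) y n := fun n j _ =>
      ⟨fun h => of_decide_eq_true h, fun h =>
        lt_of_le_of_ne (not_lt.1 (of_decide_eq_false h)) (hne j).symm⟩
    have hcell : ∀ n, y n ∈ pathCell (fun j => decide (y j < p)) y n := fun n => by
      have := (hpick _ ⟨p, hp n⟩).1
      rwa [← hy] at this
    have hrank : ∀ n, ρ (y n) ≤ ρ p := fun n => by
      have := (hpick _ ⟨p, hp n⟩).2 p (hp n)
      rwa [← hy] at this
    have hlow : ∀ d, {n | ρ (y n) = d ∧ y n < p}.Countable := fun d =>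
      hρ d _ y (fun s hs => hs.1) (Or.inl fun s hs t _ hst => (hcell t s hst).1 (by simpa using hs.2))
    have hhigh : ∀ d, {n | ρ (y n) = d ∧ p < y n}.Countable := fun d =>
      hρ d _ y (fun s hs => hs.1)
        (Or.inr fun s hs t _ hst => (hcell t s hst).2 (by simpa using hs.2.le))
    have hall : (⋃ d : Set.Iic (ρ p), {n | ρ (y n) = d ∧ y n < p} ∪
        {n | ρ (y n) = d ∧ p < y n}).Countable := by
      have := (hW (ρ p)).to_subtype
      exact Set.countable_iUnion fun d => (hlow d).union (hhigh d)
    refine Set.not_countable_univ (hall.mono fun n _ => Set.mem_iUnion.2 ⟨⟨_, hrank n⟩, ?_⟩)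
    exact (lt_or_gt_of_ne (hne n)).imp (fun h => ⟨rfl, h⟩) fun h => ⟨rfl, h⟩
  obtain ⟨n, hn⟩ := hmeet
  -- Copy the branch of `p` until it meets `p` at stage `n`, and mark that stage by the last one.
  let f : W → Bool := fun j => if j < n then decide (y j < p) else decide (j = n)
  have hf : ∀ j < n, f j = decide (y j < p) := fun j hj => if_pos hj
  have hfn : f n = true := by simp [f]
  have hfgt : ∀ j, n < j → f j = false := fun j hj => by simp [f, hj.not_gt, hj.ne']
  refine ⟨LastOne.of f n hfn hfgt, ?_⟩
  change pathPoint pick f (LastOne.last _) = p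
  rw [LastOne.last_eq (LastOne.of f n hfn hfgt) hfn hfgt, ← hn, hy n, pathPoint_eq]
  refine congrArg pick (pathCell_congr hf (pathPoint_unique fun j hj => ?_))
  rw [hy j]
  exact congrArg pick (pathCell_congr (fun k hk => (hf k (hk.trans hj)).symm) fun _ _ => rfl)

end Paths

/-! ### Cardinality and the choice of `W`. -/

open Cardinal in
theorem LastOne.mk_eq_continuum {W : Type u} [LinearOrder W] [WellFoundedLT W] [Uncountable W]
    (hW : ∀ n : W, (Set.Iic n).Countable) (hcard : #W ≤ 𝔠)
    (hbdd : ∀ S : Set W, S.Countable → ∃ m, ∀ s ∈ S, s < m) : #(LastOne W) = 𝔠 := by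
  classical
  refine le_antisymm ?_ ?_
  · let φ : LastOne W → Σ d : W, Set.Iic d → Bool := fun f => ⟨f.last, fun j => f j⟩
    have hφ : Function.Injective φ := by
      intro f g hfg
      have hlast : f.last = g.last := congrArg Sigma.fst hfg
      -- Stating this for equal pairs avoids transport along the equality of last positions.
      have hval : ∀ (p q : Σ d : W, Set.Iic d → Bool), p = q → ∀ n (hp : n ≤ p.1) (hq : n ≤ q.1),
          p.2 ⟨n, hp⟩ = q.2 ⟨n, hq⟩ := by
        rintro p _ rfl n _ _
        rfl
      refine LastOne.ext fun n => ?_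
      by_cases hn : n ≤ f.last
      · exact hval _ _ hfg n hn (hn.trans_eq hlast)
      · rw [f.apply_of_last_lt (not_le.1 hn), g.apply_of_last_lt (hlast ▸ not_le.1 hn)]
    calc #(LastOne W) ≤ #(Σ d : W, Set.Iic d → Bool) := mk_le_of_injective hφ
      _ = Cardinal.sum fun d : W => #(Set.Iic d → Bool) := mk_sigma _
      _ ≤ Cardinal.sum fun _ : W => 𝔠 := by
          refine sum_le_sum _ _ fun d => ?_
          have : #(Set.Iic d) ≤ ℵ₀ := (hW d).le_aleph0
          calc #(Set.Iic d → Bool) = 2 ^ #(Set.Iic d) := by simp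
            _ ≤ 2 ^ ℵ₀ := power_le_power_left two_ne_zero this
            _ = 𝔠 := two_power_aleph0
      _ = #W * 𝔠 := by simp
      _ ≤ 𝔠 * 𝔠 := by gcongr
      _ = 𝔠 := continuum_mul_self
  · let j : ℕ ↪ W := Infinite.natEmbedding W
    obtain ⟨m, hm⟩ := hbdd (Set.range j) (Set.countable_range j)
    have hjm : ∀ n, j n ≠ m := fun n => (hm _ ⟨n, rfl⟩).ne
    -- The one at `m`, above the whole range of `j`, supplies a last one for every coded subset.
    let ψ : Set ℕ → LastOne W := fun s => LastOne.of (fun n => decide (n ∈ j '' s ∨ n = m)) m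
      (by simp) (fun n hn => by
        simp only [decide_eq_false_iff_not, not_or]
        refine ⟨?_, hn.ne'⟩
        rintro ⟨k, -, rfl⟩
        exact (hm _ ⟨k, rfl⟩).not_gt hn)
    have hψ : Function.Injective ψ := by
      intro s t hst
      ext k
      have := congrArg (fun f : LastOne W => f (j k)) hst
      simp only [ψ, LastOne.coe_of] at this
      simpa [hjm] using this
    have := mk_le_of_injective (f := fun s : ULift.{u} (Set ℕ) => ψ s.down)
      (hψ.comp ULift.down_injective)
    simpa using this

open Cardinal in
theorem exists_omegaOne : ∃ (W : Type u) (_ : LinearOrder W), WellFoundedLT W ∧ #W = ℵ₁ ∧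
    ∀ n : W, (Set.Iic n).Countable := by
  refine ⟨(ℵ₁ : Cardinal.{u}).ord.ToType, inferInstance, inferInstance, mk_ord_toType _, ?_⟩
  intro n
  have hlt : (Set.Iio n).Countable := by
    rw [← le_aleph0_iff_set_countable, ← Order.lt_succ_iff, succ_aleph0]
    exact (mk_Iio_lt n (by simp)).trans_eq (mk_ord_toType _)
  rw [← Set.Iio_insert]
  exact hlt.insert n

/-- There is a prime countably saturated linear order of cardinality continuum, and any two prime
countably saturated linear orders are isomorphic. -/
theorem theorem12 :
    (∃ (L : Type u) (_ : LinearOrder L),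
      PrimeCountablySaturated L ∧ Cardinal.mk L = Cardinal.continuum) ∧
    ∀ (L M : Type u) [LinearOrder L] [LinearOrder M],
      PrimeCountablySaturated L → PrimeCountablySaturated M → Nonempty (L ≃o M) := by
  obtain ⟨W, _, _, hcard, hW⟩ := exists_omegaOne.{u}
  have : Uncountable W := by
    rw [← Cardinal.aleph0_lt_mk_iff, hcard]
    exact Cardinal.aleph0_lt_aleph_one
  have hbdd : ∀ S : Set W, S.Countable → ∃ m, ∀ s ∈ S, s < m := by
    intro S hS
    by_contra hcon
    push Not at hcon
    refine Set.not_countable_univ ((hS.biUnion fun s _ => hW s).mono fun m _ => ?_)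
    obtain ⟨s, hs, h⟩ := hcon m
    exact Set.mem_biUnion hs h
  have hfill : FillsCountableCuts (LastOne W) := LastOne.fillsCountableCuts hbdd
  have hiso : ∀ (L : Type u) [LinearOrder L], PrimeCountablySaturated L →
      Nonempty (LastOne W ≃o L) := by
    intro L _ hL
    -- Primeness is used only to embed `L` in the model, from which it inherits a thin rank.
    obtain ⟨e⟩ := hL.2 _ hfill.countablySaturated
    exact LastOne.nonempty_orderIso hW hL.1.fillsCountableCuts
      ((LastOne.hasThinRank hW).of_orderEmbedding e)
  refine ⟨⟨LastOne W, inferInstance, ⟨hfill.countablySaturated, fun X _ hX => ?_⟩,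
    LastOne.mk_eq_continuum hW (hcard.trans_le Cardinal.aleph_one_le_continuum) hbdd⟩, ?_⟩
  · exact LastOne.nonempty_orderEmbedding (fun n => (hW n).mono Set.Iio_subset_Iic_self)
      hX.fillsCountableCuts
  · intro L M _ _ hL hM
    obtain ⟨e⟩ := hiso L hL
    obtain ⟨e'⟩ := hiso M hM
    exact ⟨e.symm.trans e'⟩
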